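/- Let $\mathbb{R}\{\{h\}\}\subset\mathbb{R}[[h]]$ be the ring of formal power series with nonzero radius of convergence, and let $\mathbb{R}(\{h\})\subset\mathbb{R}((h))$ be its field of fractions, the field of convergent Laurent series. Let $\epsilon$ be the automorphism $f(h)\mapsto f(-h)$ of $\mathbb{R}((h))$. For a subfield $L\subset\mathbb{R}((h))$ put $U_N^{\epsilon}(L)=\{X\in \mathrm{GL}_N(L)\mid X^{-1}={}^t\epsilon(X)\}$, where $\epsilon$ is applied to each entry. A representation over a field is called absolutely irreducible if it is irreducible after extension of scalars to an algebraic closure of the field; irreducible representations are nonzero. Let $G$ be a finitely generated group, $N\geq 0$ an integer, $R:G\to \mathrm{GL}_N(\mathbb{R}[[h]])$ a homomorphism, $g_1,\dots,g_r\in G$ elements such that the matrices $R(g_1),\dots,R(g_r)$ have entries in $\mathbb{R}\{\{h\}\}$, and $M>0$ an integer. Then there exists a homomorphism $R^*:G\to \mathrm{GL}_N(\mathbb{R}\{\{h\}\})$ such that all of the following hold: 1. $R^*(g_i)=R(g_i)$ for $i=1,\dots,r$; 2. $R^*(g)\equiv R(g)$ modulo $h^M$, entrywise, for all $g\in G$;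 3. if $R(G)\subset U_N^{\epsilon}(\mathbb{R}((h)))$, then $R^*(G)\subset U_N^{\epsilon}(\mathbb{R}(\{h\}))$; 4. if $R$ is absolutely irreducible as a representation over $\mathbb{R}((h))$, then $R^*$ is absolutely irreducible as a representation over $\mathbb{R}(\{h\})$. -/

import Mathlib

open scoped PowerSeries LaurentSeries

namespace ConvergentApproximation

/-- The formal power series `f` has nonzero radius of convergence. -/
def HasPosRadius (f : ℝ⟦X⟧) : Prop :=
  0 < (FormalMultilinearSeries.ofScalars ℝ (fun n => PowerSeries.coeff n f)).radius

theorem hasPosRadius_iff (f : ℝ⟦X⟧) :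
    HasPosRadius f ↔ ∃ r : ℝ, 0 < r ∧ Summable fun n => ‖PowerSeries.coeff n f * r ^ n‖ := by
  unfold HasPosRadius
  constructor
  · intro h
    obtain ⟨r, hr0, hr⟩ := ENNReal.lt_iff_exists_nnreal_btwn.1 h
    refine ⟨r, by exact_mod_cast hr0, ?_⟩
    have := FormalMultilinearSeries.summable_norm_mul_pow _ hr
    simpa [FormalMultilinearSeries.ofScalars_norm] using this
  · rintro ⟨r, hr, hs⟩
    lift r to NNReal using hr.le
    refine lt_of_lt_of_le (b := (r : ENNReal)) (by exact_mod_cast hr) ?_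
    apply FormalMultilinearSeries.le_radius_of_summable_norm
    simpa [FormalMultilinearSeries.ofScalars_norm] using hs

theorem summable_shrink {a : ℕ → ℝ} {r s : ℝ} (hs : 0 < s) (hsr : s ≤ r)
    (h : Summable fun n => ‖a n * r ^ n‖) : Summable fun n => ‖a n * s ^ n‖ := by
  refine Summable.of_nonneg_of_le (fun _ => norm_nonneg _) (fun n => ?_) h
  rw [norm_mul, norm_mul, norm_pow, norm_pow, Real.norm_of_nonneg hs.le,
    Real.norm_of_nonneg (hs.le.trans hsr)]
  gcongr

theorem hasPosRadius_coe (p : Polynomial ℝ) : HasPosRadius (p : ℝ⟦X⟧) := by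
  refine (hasPosRadius_iff _).2 ⟨1, one_pos, ?_⟩
  refine summable_of_ne_finset_zero (s := p.support) fun n hn => ?_
  simp only [Polynomial.mem_support_iff, not_not] at hn
  simp [hn]

theorem HasPosRadius.neg {f : ℝ⟦X⟧} (hf : HasPosRadius f) : HasPosRadius (-f) := by
  obtain ⟨r, hr, h⟩ := (hasPosRadius_iff _).1 hf
  exact (hasPosRadius_iff _).2 ⟨r, hr, by simpa using h⟩

theorem HasPosRadius.exists_common {f g : ℝ⟦X⟧} (hf : HasPosRadius f) (hg : HasPosRadius g) :
    ∃ r : ℝ, 0 < r ∧ (Summable fun n => ‖PowerSeries.coeff n f * r ^ n‖) ∧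
      Summable fun n => ‖PowerSeries.coeff n g * r ^ n‖ := by
  obtain ⟨r, hr, h⟩ := (hasPosRadius_iff _).1 hf
  obtain ⟨s, hs, h'⟩ := (hasPosRadius_iff _).1 hg
  have hm : 0 < min r s := lt_min hr hs
  exact ⟨min r s, hm, summable_shrink hm (min_le_left _ _) h,
    summable_shrink hm (min_le_right _ _) h'⟩

theorem HasPosRadius.add {f g : ℝ⟦X⟧} (hf : HasPosRadius f) (hg : HasPosRadius g) :
    HasPosRadius (f + g) := by
  obtain ⟨r, hr, h, h'⟩ := hf.exists_common hg
  refine (hasPosRadius_iff _).2 ⟨r, hr, ?_⟩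
  refine Summable.of_nonneg_of_le (fun _ => norm_nonneg _) (fun n => ?_) (h.add h')
  rw [map_add, add_mul]
  exact norm_add_le _ _

theorem HasPosRadius.mul {f g : ℝ⟦X⟧} (hf : HasPosRadius f) (hg : HasPosRadius g) :
    HasPosRadius (f * g) := by
  obtain ⟨r, hr, h, h'⟩ := hf.exists_common hg
  refine (hasPosRadius_iff _).2 ⟨r, hr, ?_⟩
  refine (summable_norm_sum_mul_antidiagonal_of_summable_norm h h').congr fun n => ?_
  congr 1
  symm
  rw [PowerSeries.coeff_mul, Finset.sum_mul]
  refine Finset.sum_congr rfl fun kl hkl => ?_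
  rw [← Finset.HasAntidiagonal.mem_antidiagonal.1 hkl, pow_add]
  ring

/-- The ring `ℝ{{h}}` of convergent power series, as a subring of `ℝ[[h]]`. -/
def convergentSeries : Subring ℝ⟦X⟧ where
  carrier := {f | HasPosRadius f}
  mul_mem' := HasPosRadius.mul
  one_mem' := by simpa using hasPosRadius_coe 1
  add_mem' := HasPosRadius.add
  zero_mem' := by simpa using hasPosRadius_coe 0
  neg_mem' := HasPosRadius.neg

/-- The field `ℝ({h})` of convergent Laurent series: the field of fractions of `ℝ{{h}}`,
realised as the subfield of `ℝ((h))` that `ℝ{{h}}` generates. -/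
noncomputable def convergentLaurent : Subfield ℝ⸨X⸩ :=
  Subfield.closure ((algebraMap ℝ⟦X⟧ ℝ⸨X⸩) '' (convergentSeries : Set ℝ⟦X⟧))

/-- The inclusion `ℝ{{h}} ⊂ ℝ({h})`. -/
noncomputable def convergentSeriesToLaurent : convergentSeries →+* convergentLaurent :=
  ((algebraMap ℝ⟦X⟧ ℝ⸨X⸩).comp convergentSeries.subtype).codRestrict convergentLaurent
    fun f => Subfield.subset_closure ⟨f, f.2, rfl⟩

/-- Underlying function of `epsilon`: the coefficient `aₙ` becomes `(-1)ⁿ aₙ`. -/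
noncomputable def epsilonFun (f : ℝ⸨X⸩) : ℝ⸨X⸩ where
  coeff n := (-1 : ℝ) ^ n * f.coeff n
  isPWO_support' := f.isPWO_support.mono fun n hn => by
    simp only [Function.mem_support] at hn
    exact right_ne_zero_of_mul hn

theorem support_epsilonFun (f : ℝ⸨X⸩) : (epsilonFun f).support = f.support := by
  ext n
  have : ((-1 : ℝ) ^ n) ≠ 0 := zpow_ne_zero _ (by norm_num)
  simp [epsilonFun, HahnSeries.mem_support, this]

theorem epsilonFun_epsilonFun (f : ℝ⸨X⸩) : epsilonFun (epsilonFun f) = f := by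
  ext n
  change (-1 : ℝ) ^ n * ((-1 : ℝ) ^ n * f.coeff n) = f.coeff n
  rw [← mul_assoc, ← mul_zpow]
  simp

/-- The automorphism `ε : f(h) ↦ f(-h)` of `ℝ((h))`. -/
noncomputable def epsilon : ℝ⸨X⸩ ≃+* ℝ⸨X⸩ where
  toFun := epsilonFun
  invFun := epsilonFun
  left_inv := epsilonFun_epsilonFun
  right_inv := epsilonFun_epsilonFun
  map_add' f g := by
    ext n
    exact mul_add _ _ _
  map_mul' f g := by
    ext n
    change (-1 : ℝ) ^ n * (f * g).coeff n = _
    rw [HahnSeries.coeff_mul, HahnSeries.coeff_mul, Finset.mul_sum]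
    refine Finset.sum_congr (by simp only [support_epsilonFun]) fun kl hkl => ?_
    rw [← (Finset.mem_antidiagonal.1 hkl).2.2, zpow_add₀ (by norm_num)]
    change _ = ((-1 : ℝ) ^ kl.1 * f.coeff kl.1) * ((-1 : ℝ) ^ kl.2 * g.coeff kl.2)
    ring

/-- `U_N^ε(L) = {X ∈ GL_N(L) | X⁻¹ = ᵗε(X)}`, as a set of elements of `GL_N(ℝ((h)))`. -/
def epsilonUnitary (N : ℕ) (L : Subfield ℝ⸨X⸩) : Set (GL (Fin N) ℝ⸨X⸩) :=
  {X | X ∈ (Matrix.GeneralLinearGroup.map (n := Fin N) L.subtype).range ∧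
    ((X⁻¹ : GL (Fin N) ℝ⸨X⸩) : Matrix (Fin N) (Fin N) ℝ⸨X⸩) =
      ((X : Matrix (Fin N) (Fin N) ℝ⸨X⸩).map epsilon).transpose}

/-- The representation on the column space `Kᴺ` given by a homomorphism to `GL_N(K)`. -/
noncomputable def matrixRep {G K : Type*} [Group G] [Field K] {N : ℕ}
    (ρ : G →* GL (Fin N) K) : Representation K G (Fin N → K) :=
  (Units.coeHom (Module.End K (Fin N → K))).comp
    ((Matrix.GeneralLinearGroup.toLin (n := Fin N) (R := K)).toMonoidHom.comp ρ)

/-- `ρ` is absolutely irreducible: it is irreducible over an algebraic closure of `K`. -/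
def IsAbsolutelyIrreducible {G K : Type*} [Group G] [Field K] {N : ℕ}
    (ρ : G →* GL (Fin N) K) : Prop :=
  (matrixRep ((Matrix.GeneralLinearGroup.map
    (algebraMap K (AlgebraicClosure K))).comp ρ)).IsIrreducible

end ConvergentApproximation

/-!
The proof is an Artin approximation over the ring `A = ℝ{{h}}` of convergent power series. The
entries of `R` lie in a subring `B` of `ℝ[[h]]` generated over `A` by finitely many series, since
`G` is finitely generated. It suffices to find ring homomorphisms `φ : B → A` that fix the elements
of `A` in `B`, commute with `ε`, and are congruent to the inclusion modulo an arbitrary power of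
`h`: the representation `R* = φ ∘ R` then has the first three properties at once.

Such homomorphisms are built by adjoining one generator `t` at a time
(`IsApproximable.adjoin`). If `t` is transcendental over the ring `B` obtained so far, it may be
sent to any of its truncations. If it is algebraic, let `f` be a polynomial over `B` of least
degree vanishing at `t`. In characteristic zero `f'(t) ≠ 0`, so a sufficiently precise `φ` on `B`
turns `f` into a polynomial over `A` of which `t` is an approximate root, and Hensel's lemma gives a
convergent root close to `t`. By pseudo-division by `f`, all relations satisfied by `t` over `B` are
preserved (`map_eq_zero_of_minimal`). Hensel's lemma over `A` (`exists_convergent_root`) reduces to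
the fixed-point equation `S = c + b S + S² Q(S)`, whose formal solution converges because its
iterates stay in a ball for a weighted `ℓ¹`-norm (`exists_fixedPoint`).

To make `φ` commute with `ε`, the approximation is applied to the even and odd parts of the entries,
seen as series in `h²`, and extended `h`-linearly (`exists_equivariant_approximation`).

For absolute irreducibility, Burnside's theorem says that a representation over a field is
absolutely irreducible exactly when `N > 0` and some `N²` of its matrices are linearly independent,
that is, when some determinant in their entries is nonzero (`isAbsolutelyIrreducible_iff`). If `φ`
is congruent to the inclusion modulo a power of `h` beyond the order of that determinant for `R`,
then the corresponding determinant for `R*` is nonzero too.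
-/

namespace ConvergentApproximation

open scoped ENNReal NNReal Polynomial

/-! ### Weighted norms on power series -/

/-- The weighted `ℓ¹`-norm `∑ |aₙ| rⁿ` of a power series, with values in `[0, ∞]` so that no
summability has to be tracked. -/
noncomputable def wnorm (r : ℝ≥0) (f : ℝ⟦X⟧) : ℝ≥0∞ :=
  ∑' n, ‖PowerSeries.coeff n f‖ₑ * (r : ℝ≥0∞) ^ n

theorem hasPosRadius_iff_wnorm (f : ℝ⟦X⟧) : HasPosRadius f ↔ ∃ r : ℝ≥0, 0 < r ∧ wnorm r f ≠ ∞ := by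
  have key : ∀ r : ℝ≥0, (Summable fun n => ‖PowerSeries.coeff n f * (r : ℝ) ^ n‖) ↔
      wnorm r f ≠ ∞ := by
    intro r
    have h1 : wnorm r f = ∑' n, ((‖PowerSeries.coeff n f‖₊ * r ^ n : ℝ≥0) : ℝ≥0∞) := by
      simp [wnorm, enorm_eq_nnnorm]
    rw [h1, ENNReal.tsum_coe_ne_top_iff_summable, ← NNReal.summable_coe]
    simp
  rw [hasPosRadius_iff]
  constructor
  · rintro ⟨r, hr, h⟩
    lift r to ℝ≥0 using hr.le
    exact ⟨r, by exact_mod_cast hr, (key r).1 h⟩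
  · rintro ⟨r, hr, h⟩
    exact ⟨r, by exact_mod_cast hr, (key r).2 h⟩

theorem wnorm_mono {r s : ℝ≥0} (h : r ≤ s) (f : ℝ⟦X⟧) : wnorm r f ≤ wnorm s f := by
  unfold wnorm
  gcongr

theorem wnorm_add_le (r : ℝ≥0) (f g : ℝ⟦X⟧) : wnorm r (f + g) ≤ wnorm r f + wnorm r g := by
  unfold wnorm
  rw [← ENNReal.tsum_add]
  refine ENNReal.tsum_le_tsum fun n => ?_
  rw [map_add, ← add_mul]
  gcongr
  exact enorm_add_le _ _

theorem wnorm_mul_le (r : ℝ≥0) (f g : ℝ⟦X⟧) : wnorm r (f * g) ≤ wnorm r f * wnorm r g := by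
  unfold wnorm
  rw [← ENNReal.tsum_mul_right]
  simp_rw [← ENNReal.tsum_mul_left]
  rw [← ENNReal.tsum_prod (f := fun i j => ‖PowerSeries.coeff i f‖ₑ * (r : ℝ≥0∞) ^ i *
    (‖PowerSeries.coeff j g‖ₑ * (r : ℝ≥0∞) ^ j)),
    ← (Finset.HasAntidiagonal.sigmaAntidiagonalEquivProd (A := ℕ)).tsum_eq, ENNReal.tsum_sigma']
  refine ENNReal.tsum_le_tsum fun n => ?_
  rw [PowerSeries.coeff_mul, tsum_fintype]
  simp only [Finset.HasAntidiagonal.sigmaAntidiagonalEquivProd_apply]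
  rw [Finset.univ_eq_attach, Finset.sum_attach (Finset.HasAntidiagonal.antidiagonal n)
    (fun p : ℕ × ℕ => ‖PowerSeries.coeff p.1 f‖ₑ * (r : ℝ≥0∞) ^ p.1 *
    (‖PowerSeries.coeff p.2 g‖ₑ * (r : ℝ≥0∞) ^ p.2))]
  refine (mul_le_mul_left (enorm_sum_le _ _) _).trans ?_
  rw [Finset.sum_mul]
  refine Finset.sum_le_sum fun p hp => ?_
  rw [enorm_mul, ← Finset.HasAntidiagonal.mem_antidiagonal.1 hp, pow_add]
  exact le_of_eq (by ring)

theorem wnorm_zero (r : ℝ≥0) : wnorm r 0 = 0 := by simp [wnorm]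

theorem wnorm_one (r : ℝ≥0) : wnorm r 1 = 1 := by
  unfold wnorm
  rw [tsum_eq_single 0]
  · simp
  · intro n hn
    simp [PowerSeries.coeff_one, hn]

theorem wnorm_pow_le (r : ℝ≥0) (f : ℝ⟦X⟧) (n : ℕ) : wnorm r (f ^ n) ≤ wnorm r f ^ n := by
  induction n with
  | zero => simp [wnorm_one]
  | succ n ih =>
    rw [pow_succ, pow_succ]
    exact (wnorm_mul_le _ _ _).trans (by gcongr)

theorem wnorm_sum_le {ι : Type*} (r : ℝ≥0) (s : Finset ι) (f : ι → ℝ⟦X⟧) :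
    wnorm r (∑ i ∈ s, f i) ≤ ∑ i ∈ s, wnorm r (f i) :=
  Finset.le_sum_of_subadditive _ (wnorm_zero r).le (wnorm_add_le r) s f

theorem wnorm_X_mul (r : ℝ≥0) (f : ℝ⟦X⟧) : wnorm r (PowerSeries.X * f) = r * wnorm r f := by
  unfold wnorm
  rw [tsum_eq_zero_add' ENNReal.summable, ← ENNReal.tsum_mul_left]
  simp only [PowerSeries.coeff_zero_X_mul, PowerSeries.coeff_succ_X_mul, enorm_zero, zero_mul,
    zero_add, pow_succ]
  exact tsum_congr fun n => by ring

theorem wnorm_ne_top_of_le {r s : ℝ≥0} {f : ℝ⟦X⟧} (h : r ≤ s) (hs : wnorm s f ≠ ∞) :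
    wnorm r f ≠ ∞ := ne_top_of_le_ne_top hs (wnorm_mono h f)

/-- If every truncation of `f` agrees with a series of norm at most `C`, then so does `f`. -/
theorem wnorm_le_of_forall_dvd {r : ℝ≥0} {C : ℝ≥0∞} {f : ℝ⟦X⟧}
    (h : ∀ n, ∃ g, PowerSeries.X ^ n ∣ f - g ∧ wnorm r g ≤ C) : wnorm r f ≤ C := by
  unfold wnorm
  rw [ENNReal.tsum_eq_iSup_nat]
  refine iSup_le fun n => ?_
  obtain ⟨g, hg, hgC⟩ := h n
  refine le_trans ?_ hgC
  refine le_trans (le_of_eq ?_) (ENNReal.sum_le_tsum (Finset.range n))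
  refine Finset.sum_congr rfl fun i hi => ?_
  have := PowerSeries.X_pow_dvd_iff.1 hg i (Finset.mem_range.1 hi)
  rw [map_sub, sub_eq_zero] at this
  rw [this]

/-! ### Closure properties of convergent series -/

theorem X_mem : (PowerSeries.X : ℝ⟦X⟧) ∈ convergentSeries := by
  have := hasPosRadius_coe Polynomial.X
  rwa [Polynomial.coe_X] at this

theorem C_mem (a : ℝ) : (PowerSeries.C a : ℝ⟦X⟧) ∈ convergentSeries := by
  have := hasPosRadius_coe (Polynomial.C a)
  rwa [Polynomial.coe_C] at this

theorem of_X_mul_mem {f : ℝ⟦X⟧} (h : PowerSeries.X * f ∈ convergentSeries) :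
    f ∈ convergentSeries := by
  obtain ⟨r, hr, h⟩ := (hasPosRadius_iff_wnorm _).1 h
  refine (hasPosRadius_iff_wnorm _).2 ⟨r, hr, fun h' => h ?_⟩
  rw [wnorm_X_mul, h', ENNReal.mul_top (by exact_mod_cast hr.ne')]

theorem of_X_pow_mul_mem {f : ℝ⟦X⟧} (n : ℕ) (h : PowerSeries.X ^ n * f ∈ convergentSeries) :
    f ∈ convergentSeries := by
  induction n with
  | zero => simpa using h
  | succ n ih => exact ih (of_X_mul_mem (by rwa [← mul_assoc, ← pow_succ']))

/-- Formal power series are approximated by convergent ones, namely by their truncations. -/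
theorem exists_X_pow_dvd_coe_sub (t : ℝ⟦X⟧) (n : ℕ) :
    ∃ s : convergentSeries, PowerSeries.X ^ n ∣ (s : ℝ⟦X⟧) - t := by
  refine ⟨⟨(PowerSeries.trunc n t : Polynomial ℝ), hasPosRadius_coe _⟩,
    PowerSeries.X_pow_dvd_iff.2 fun m hm => ?_⟩
  rw [map_sub, Polynomial.coeff_coe, PowerSeries.coeff_trunc, if_pos hm, sub_self]

/-! ### Solving equations in convergent series -/

/-- A convergent series without constant term has arbitrarily small norm on small discs. -/
theorem exists_wnorm_le {f : ℝ⟦X⟧} (hf : f ∈ convergentSeries) (h0 : PowerSeries.X ∣ f)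
    {δ : ℝ≥0} (hδ : 0 < δ) : ∃ s : ℝ≥0, 0 < s ∧ ∀ r ≤ s, wnorm r f ≤ δ := by
  obtain ⟨g, rfl⟩ := h0
  obtain ⟨s, hs, hg⟩ := (hasPosRadius_iff_wnorm _).1 (of_X_mul_mem hf)
  lift wnorm s g to ℝ≥0 using hg with K hK
  refine ⟨min s (δ / (K + 1)), by positivity, fun r hr => ?_⟩
  rw [wnorm_X_mul]
  refine (mul_le_mul_right (wnorm_mono (hr.trans (min_le_left _ _)) g) _).trans ?_
  rw [← hK]
  norm_cast
  calc r * K ≤ δ / (K + 1) * (K + 1) := by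
        gcongr
        · exact hr.trans (min_le_right _ _)
        · simp
    _ = δ := by field_simp

/-- The value of a polynomial with convergent coefficients is bounded on the unit ball, uniformly
for all small discs. -/
theorem exists_wnorm_eval_le {Q : ℝ⟦X⟧[X]} (hQ : ∀ i, Q.coeff i ∈ convergentSeries) :
    ∃ (s K : ℝ≥0), 0 < s ∧ ∀ r ≤ s, ∀ f, wnorm r f ≤ 1 → wnorm r (Q.eval f) ≤ K := by
  choose s hs hsQ using fun i => (hasPosRadius_iff_wnorm _).1 (hQ i)
  let I := Finset.range (Q.natDegree + 1)
  have hI : I.Nonempty := ⟨0, by simp [I]⟩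
  let t : ℝ≥0 := I.inf' hI s
  have ht : ∑ i ∈ I, wnorm t (Q.coeff i) ≠ ∞ :=
    ENNReal.sum_ne_top.2 fun i hi => wnorm_ne_top_of_le (Finset.inf'_le _ hi) (hsQ i)
  refine ⟨t, (∑ i ∈ I, wnorm t (Q.coeff i)).toNNReal, ?_, fun r hr f hf => ?_⟩
  · exact (Finset.lt_inf'_iff hI).2 fun i _ => hs i
  · rw [ENNReal.coe_toNNReal ht, Polynomial.eval_eq_sum_range]
    refine (wnorm_sum_le _ _ _).trans (Finset.sum_le_sum fun i _ => ?_)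
    calc wnorm r (Q.coeff i * f ^ i) ≤ wnorm r (Q.coeff i) * wnorm r (f ^ i) := wnorm_mul_le _ _ _
      _ ≤ wnorm t (Q.coeff i) * 1 := by
        gcongr
        · exact wnorm_mono hr _
        · exact (wnorm_pow_le _ _ _).trans (pow_le_one' hf _)
      _ = _ := mul_one _

/-- The equation `S = c + b S + S² Q(S)` with `c` and `b` divisible by `X` has a convergent
solution. The iterates of the right-hand side starting from `0` converge `X`-adically, and for a
small enough radius all of them lie in a fixed ball for the weighted norm. -/
theorem exists_fixedPoint {c b : ℝ⟦X⟧} {Q : ℝ⟦X⟧[X]} (hc : c ∈ convergentSeries)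
    (hb : b ∈ convergentSeries) (hQ : ∀ i, Q.coeff i ∈ convergentSeries)
    (hc0 : PowerSeries.X ∣ c) (hb0 : PowerSeries.X ∣ b) :
    ∃ S ∈ convergentSeries, S = c + b * S + S ^ 2 * Q.eval S := by
  obtain ⟨s, K, hs, hK⟩ := exists_wnorm_eval_le hQ
  -- this choice gives `ρ K ≤ 1 / 4`, so that the ball of radius `ρ` is stable under the
  -- right-hand side once the norms of `c` and `b` are small
  let ρ : ℝ≥0 := 1 / (4 * (K + 1))
  have hρ : 0 < ρ := by positivity
  have hρ1 : ρ ≤ 1 := by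
    apply div_le_one_of_le₀ _ (by positivity)
    have : (0 : ℝ≥0) ≤ K := zero_le
    nlinarith
  have hρK : ρ * K ≤ 1 / 4 := by
    rw [div_mul_eq_mul_div, div_le_div_iff₀ (by positivity) (by positivity)]
    have : (0 : ℝ≥0) ≤ K := zero_le
    nlinarith
  obtain ⟨s₁, hs₁, h₁⟩ := exists_wnorm_le hc hc0 (δ := ρ / 4) (by positivity)
  obtain ⟨s₂, hs₂, h₂⟩ := exists_wnorm_le hb hb0 (δ := 1 / 4) (by positivity)
  let r := min s (min s₁ s₂)
  have hr : 0 < r := lt_min hs (lt_min hs₁ hs₂)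
  let Φ : ℝ⟦X⟧ → ℝ⟦X⟧ := fun S => c + b * S + S ^ 2 * Q.eval S
  have hball : ∀ S, wnorm r S ≤ ρ → wnorm r (Φ S) ≤ ρ := by
    intro S hS
    have e1 : wnorm r c ≤ (ρ / 4 : ℝ≥0) := h₁ r ((min_le_right _ _).trans (min_le_left _ _))
    have e2 : wnorm r b ≤ (1 / 4 : ℝ≥0) := h₂ r ((min_le_right _ _).trans (min_le_right _ _))
    have e3 : wnorm r (Q.eval S) ≤ K :=
      hK r (min_le_left _ _) S (hS.trans (by exact_mod_cast hρ1))
    calc wnorm r (Φ S) ≤ wnorm r c + wnorm r b * wnorm r S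
          + wnorm r S ^ 2 * wnorm r (Q.eval S) := by
          refine (wnorm_add_le _ _ _).trans (add_le_add ((wnorm_add_le _ _ _).trans ?_) ?_)
          · gcongr
            exact wnorm_mul_le _ _ _
          · refine (wnorm_mul_le _ _ _).trans ?_
            gcongr
            exact wnorm_pow_le _ _ _
      _ ≤ (ρ / 4 : ℝ≥0) + (1 / 4 : ℝ≥0) * ρ + ρ ^ 2 * K := by gcongr
      _ = ((ρ / 4 + 1 / 4 * ρ + ρ * (ρ * K) : ℝ≥0) : ℝ≥0∞) := by push_cast; ring
      _ ≤ ((ρ / 4 + 1 / 4 * ρ + ρ * (1 / 4) : ℝ≥0) : ℝ≥0∞) := by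
          apply ENNReal.coe_le_coe.2
          gcongr
      _ ≤ ρ := by
          apply ENNReal.coe_le_coe.2
          rw [← NNReal.coe_le_coe]
          push_cast
          have := ρ.2
          change (0 : ℝ) ≤ (ρ : ℝ) at this
          linarith
  have hdvd : ∀ S, PowerSeries.X ∣ S → PowerSeries.X ∣ Φ S := fun S hS =>
    dvd_add (dvd_add hc0 (hS.mul_left _)) ((dvd_pow hS two_ne_zero).mul_right _)
  -- on series without constant term the right-hand side is `X`-adically contracting
  have hcontr : ∀ n S S', PowerSeries.X ∣ S → PowerSeries.X ∣ S' → PowerSeries.X ^ n ∣ S - S' →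
      PowerSeries.X ^ (n + 1) ∣ Φ S - Φ S' := by
    intro n S S' hS hS' h
    have e : Φ S - Φ S' = (S - S') * b + (S - S') * ((S + S') * Q.eval S) +
        (Q.eval S - Q.eval S') * S' ^ 2 := by
      simp only [Φ]; ring
    rw [e, pow_succ]
    refine dvd_add (dvd_add (mul_dvd_mul h hb0)
      (mul_dvd_mul h ((dvd_add hS hS').mul_right _))) (mul_dvd_mul ?_ (dvd_pow hS' two_ne_zero))
    exact h.trans (Polynomial.sub_dvd_eval_sub _ _ _)
  let u : ℕ → ℝ⟦X⟧ := fun n => Φ^[n] 0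
  have hu : ∀ n, u (n + 1) = Φ (u n) := fun n => Function.iterate_succ_apply' _ _ _
  have huX : ∀ n, PowerSeries.X ∣ u n := by
    intro n
    induction n with
    | zero => simp [u]
    | succ n ih => rw [hu]; exact hdvd _ ih
  have huρ : ∀ n, wnorm r (u n) ≤ ρ := by
    intro n
    induction n with
    | zero => simp [u, wnorm_zero]
    | succ n ih => rw [hu]; exact hball _ ih
  have hstep : ∀ n, PowerSeries.X ^ n ∣ u (n + 1) - u n := by
    intro n
    induction n with
    | zero => simp
    | succ n ih =>
      rw [hu (n + 1), hu n]
      exact hcontr n _ _ (hu n ▸ huX (n + 1)) (huX n) (hu n ▸ ih)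
  have hcauchy : ∀ n k, PowerSeries.X ^ n ∣ u (n + k) - u n := by
    intro n k
    induction k with
    | zero => simp
    | succ k ih =>
      have := dvd_add ((pow_dvd_pow _ (Nat.le_add_right n k)).trans (hstep (n + k))) ih
      simpa [add_assoc] using this
  let S : ℝ⟦X⟧ := PowerSeries.mk fun n => PowerSeries.coeff n (u (n + 1))
  have hS : ∀ n, PowerSeries.X ^ n ∣ S - u n := by
    intro n
    refine PowerSeries.X_pow_dvd_iff.2 fun m hm => ?_
    obtain ⟨k, rfl⟩ := Nat.exists_eq_add_of_lt hm
    have := PowerSeries.X_pow_dvd_iff.1 (hcauchy (m + 1) k) m (Nat.lt_succ_self m)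
    rw [map_sub, sub_eq_zero] at this
    rw [map_sub, PowerSeries.coeff_mk, ← this, show m + 1 + k = m + k + 1 by ring, sub_self]
  have hSX : PowerSeries.X ∣ S := by
    have := dvd_add (by simpa using hS 1) (huX 1)
    simpa using this
  refine ⟨S, (hasPosRadius_iff_wnorm _).2 ⟨r, hr, ?_⟩, ?_⟩
  · exact ne_top_of_le_ne_top ENNReal.coe_ne_top
      (wnorm_le_of_forall_dvd fun n => ⟨u n, hS n, huρ n⟩)
  · change S = Φ S
    rw [← sub_eq_zero]
    ext m
    have h1 : PowerSeries.X ^ (m + 1) ∣ S - Φ S := by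
      have := dvd_sub (hS (m + 1)) ((pow_dvd_pow _ (Nat.le_succ _)).trans
        (hcontr (m + 1) _ _ hSX (huX _) (hS (m + 1))))
      have h2 := hstep (m + 1)
      rw [hu (m + 1)] at h2
      convert dvd_sub this h2 using 1
      ring
    simpa using PowerSeries.X_pow_dvd_iff.1 h1 m (Nat.lt_succ_self m)

/-- **Hensel's lemma** for convergent series, in Tougeron's form: an approximate formal root `t`
of a polynomial with convergent coefficients is close to a convergent root, provided the precision
exceeds twice the order `e` of the derivative at `t`. -/
theorem exists_convergent_root (F : convergentSeries[X]) (t : ℝ⟦X⟧) (e n : ℕ)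
    (h0 : PowerSeries.X ^ (2 * e + 1 + n) ∣ F.eval₂ convergentSeries.subtype t)
    (h1 : PowerSeries.X ^ e ∣ F.derivative.eval₂ convergentSeries.subtype t)
    (h1' : ¬ PowerSeries.X ^ (e + 1) ∣ F.derivative.eval₂ convergentSeries.subtype t) :
    ∃ s : convergentSeries, F.eval s = 0 ∧ PowerSeries.X ^ n ∣ (s : ℝ⟦X⟧) - t := by
  let ι := convergentSeries.subtype
  let k := 2 * e + 1 + n
  obtain ⟨t₀, ht₀⟩ : ∃ t₀, PowerSeries.X ^ k ∣ ι t₀ - t := exists_X_pow_dvd_coe_sub t k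
  have hclose : ∀ P : convergentSeries[X],
      PowerSeries.X ^ k ∣ ι (P.eval t₀) - P.eval₂ ι t := by
    intro P
    rw [← Polynomial.eval₂_at_apply, ← Polynomial.eval_map, ← Polynomial.eval_map]
    exact ht₀.trans (Polynomial.sub_dvd_eval_sub _ _ _)
  obtain ⟨c₁, hc₁⟩ : PowerSeries.X ^ k ∣ ι (F.eval t₀) := by
    exact (dvd_iff_dvd_of_dvd_sub (hclose F)).2 h0
  have hek : e + 1 ≤ k := by omega
  obtain ⟨u, hu⟩ : PowerSeries.X ^ e ∣ ι (F.derivative.eval t₀) := by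
    exact (dvd_iff_dvd_of_dvd_sub ((pow_dvd_pow _ (by omega)).trans (hclose F.derivative))).2 h1
  have hc₁m : c₁ ∈ convergentSeries :=
    of_X_pow_mul_mem k (by rw [← hc₁]; exact (F.eval t₀).2)
  have hum : u ∈ convergentSeries :=
    of_X_pow_mul_mem e (by rw [← hu]; exact (F.derivative.eval t₀).2)
  let a := PowerSeries.constantCoeff u
  have ha : a ≠ 0 := by
    intro ha
    refine h1' ?_
    obtain ⟨v, hv⟩ := PowerSeries.X_dvd_iff.2 ha
    have h2 : PowerSeries.X ^ (e + 1) ∣ ι (F.derivative.eval t₀) := by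
      rw [hu, hv, pow_succ]
      exact mul_dvd_mul_left _ (dvd_mul_right _ _)
    exact (dvd_iff_dvd_of_dvd_sub ((pow_dvd_pow _ hek).trans (hclose F.derivative))).1 h2
  have haC : (PowerSeries.C a : ℝ⟦X⟧) * PowerSeries.C a⁻¹ = 1 := by
    rw [← map_mul, mul_inv_cancel₀ ha, map_one]
  let q := ((Polynomial.taylor t₀ F).divX).divX
  have htaylor : ∀ z : ℝ⟦X⟧, F.eval₂ ι (z + ι t₀) =
      ι (F.eval t₀) + ι (F.derivative.eval t₀) * z + z ^ 2 * q.eval₂ ι z := by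
    intro z
    have e1 := Polynomial.divX_mul_X_add (Polynomial.taylor t₀ F)
    have e2 := Polynomial.divX_mul_X_add (Polynomial.taylor t₀ F).divX
    rw [Polynomial.coeff_divX, zero_add, Polynomial.taylor_coeff_one] at e2
    rw [Polynomial.taylor_coeff_zero, ← e2] at e1
    have e3 : F.eval₂ ι (z + ι t₀) = (Polynomial.taylor t₀ F).eval₂ ι z := by
      rw [Polynomial.taylor_apply, Polynomial.eval₂_comp]
      simp
    rw [e3, ← e1]
    simp only [Polynomial.eval₂_add, Polynomial.eval₂_mul, Polynomial.eval₂_X,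
      Polynomial.eval₂_C]
    ring
  -- substitute `z = X ^ (e + n) * S` and divide by `X ^ (2 * e + n)`
  let x : convergentSeries := ⟨PowerSeries.X, X_mem⟩
  let a' : convergentSeries := ⟨PowerSeries.C a⁻¹, C_mem _⟩
  let Q : convergentSeries[X] :=
    Polynomial.C (-a' * x ^ n) * q.comp (Polynomial.C (x ^ (e + n)) * Polynomial.X)
  have hQ : ∀ S, (Q.map ι).eval S = -PowerSeries.C a⁻¹ * PowerSeries.X ^ n *
      q.eval₂ ι (PowerSeries.X ^ (e + n) * S) := by
    intro S
    rw [Polynomial.eval_map]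
    simp only [Q, Polynomial.eval₂_mul, Polynomial.eval₂_comp, Polynomial.eval₂_C,
      Polynomial.eval₂_X]
    rfl
  obtain ⟨S, hS, hSeq⟩ := exists_fixedPoint (c := -PowerSeries.C a⁻¹ * (PowerSeries.X * c₁))
    (b := -PowerSeries.C a⁻¹ * (u - PowerSeries.C a)) (Q := Q.map ι)
    (mul_mem (neg_mem (C_mem _)) (mul_mem X_mem hc₁m))
    (mul_mem (neg_mem (C_mem _)) (sub_mem hum (C_mem _)))
    (fun i => by rw [Polynomial.coeff_map]; exact (Q.coeff i).2)
    ((dvd_mul_right _ _).mul_left _)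
    (Dvd.dvd.mul_left (PowerSeries.X_dvd_iff.2 (by simp [a])) _)
  refine ⟨x ^ (e + n) * ⟨S, hS⟩ + t₀, ?_, ?_⟩
  · apply Subtype.val_injective
    change ι _ = ι 0
    have e1 : ι (x ^ (e + n) * ⟨S, hS⟩ + t₀) = PowerSeries.X ^ (e + n) * S + ι t₀ := rfl
    rw [← Polynomial.eval₂_at_apply, e1, htaylor, hc₁, hu, map_zero]
    rw [hQ] at hSeq
    set w := q.eval₂ ι (PowerSeries.X ^ (e + n) * S)
    have e2 : PowerSeries.X * c₁ + u * S + PowerSeries.X ^ n * S ^ 2 * w = 0 := by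
      linear_combination PowerSeries.C a * hSeq - (PowerSeries.X * c₁ + (u - PowerSeries.C a) * S
        + PowerSeries.X ^ n * S ^ 2 * w) * haC
    have e3 : PowerSeries.X ^ k * c₁ + PowerSeries.X ^ e * u * (PowerSeries.X ^ (e + n) * S) +
        (PowerSeries.X ^ (e + n) * S) ^ 2 * w = PowerSeries.X ^ (2 * e + n) *
        (PowerSeries.X * c₁ + u * S + PowerSeries.X ^ n * S ^ 2 * w) := by
      simp only [k]; ring
    rw [e3, e2, mul_zero]
  · change _ ∣ PowerSeries.X ^ (e + n) * S + ι t₀ - t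
    rw [add_sub_assoc]
    exact dvd_add ((pow_dvd_pow _ (by omega)).mul_right _)
      ((pow_dvd_pow _ (by omega)).trans ht₀)

/-! ### Approximation of formal solutions by convergent ones -/

/-- A subring `B` of `ℝ[[h]]` is approximable if, to any order, its inclusion is approximated by
ring homomorphisms to `ℝ{{h}}` which fix the convergent series in `B`. When `B` is generated over
`ℝ{{h}}` by `y₁, …, yₙ`, this means that for every order there are convergent series, equal to the
`yᵢ` up to that order, satisfying all the polynomial relations over `ℝ{{h}}` between the `yᵢ`. -/
def IsApproximable (B : Subring ℝ⟦X⟧) : Prop :=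
  ∀ M : ℕ, ∃ φ : B →+* convergentSeries,
    (∀ b : B, (b : ℝ⟦X⟧) ∈ convergentSeries → (φ b : ℝ⟦X⟧) = b) ∧
      ∀ b : B, PowerSeries.X ^ M ∣ (φ b : ℝ⟦X⟧) - (b : ℝ⟦X⟧)

theorem dvd_eval₂_sub_eval₂ {B R : Type*} [CommRing B] [CommRing R] {φ₁ φ₂ : B →+* R} {d s t : R}
    (h : ∀ b, d ∣ φ₁ b - φ₂ b) (hst : d ∣ s - t) (p : B[X]) :
    d ∣ p.eval₂ φ₁ s - p.eval₂ φ₂ t := by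
  let π := Ideal.Quotient.mk (Ideal.span {d})
  have hπ : ∀ a b, π a = π b ↔ d ∣ a - b := fun a b => by
    rw [Ideal.Quotient.eq, Ideal.mem_span_singleton]
  have key : (π.comp (Polynomial.eval₂RingHom φ₁ s)) = π.comp (Polynomial.eval₂RingHom φ₂ t) := by
    apply Polynomial.ringHom_ext
    · intro b
      simpa using (hπ _ _).2 (h b)
    · simpa using (hπ _ _).2 hst
  exact (hπ _ _).1 (DFunLike.congr_fun key p)

theorem exists_X_pow_dvd_and_not_dvd {f : ℝ⟦X⟧} (hf : f ≠ 0) :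
    ∃ e, PowerSeries.X ^ e ∣ f ∧ ¬ PowerSeries.X ^ (e + 1) ∣ f :=
  ⟨f.order.toNat, PowerSeries.X_pow_order_dvd, fun h => PowerSeries.coeff_order hf
    (PowerSeries.X_pow_dvd_iff.1 h _ (Nat.lt_succ_self _))⟩

/-- The vanishing ideal at `t` is controlled by a nonzero element `f` of least degree in it: by
pseudo-division, a homomorphism out of `B[X]` that kills `f` but not its leading coefficient kills
all polynomials vanishing at `t`. -/
theorem map_eq_zero_of_minimal {B R S : Type*} [CommRing B] [CommRing R] [CommRing S] [IsDomain S]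
    (ev : B[X] →+* R) (ψ : B[X] →+* S) (f : B[X]) (hf : ev f = 0) (hfdeg : 0 < f.natDegree)
    (hmin : ∀ p, p ≠ 0 → ev p = 0 → f.natDegree ≤ p.natDegree) (hψf : ψ f = 0)
    (hψc : ψ (Polynomial.C f.leadingCoeff) ≠ 0) (p : B[X]) (hp : ev p = 0) : ψ p = 0 := by
  induction hn : p.natDegree using Nat.strong_induction_on generalizing p with
  | _ n ih =>
    by_cases hp0 : p = 0
    · rw [hp0, map_zero]
    have hle := hmin p hp0 hp
    have h1 : ψ (f.cancelLeads p) = 0 :=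
      ih _ (hn ▸ Polynomial.natDegree_cancelLeads_lt_of_natDegree_le_natDegree hle
        (hfdeg.trans_le hle)) _ (by simp [Polynomial.cancelLeads, hp, hf]) rfl
    rw [Polynomial.cancelLeads, Nat.sub_eq_zero_of_le hle, map_sub, map_mul _ _ f, hψf, mul_zero,
      sub_zero, pow_zero, mul_one, map_mul] at h1
    exact (mul_eq_zero.1 h1).resolve_left hψc

/-- Adjoining one element preserves approximability. For an element algebraic over the ring, the
new value is a root, given by Hensel's lemma, of the image of a polynomial of least degree. -/
theorem IsApproximable.adjoin {B : Subring ℝ⟦X⟧} (hB : IsApproximable B)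
    (hAB : convergentSeries ≤ B) (t : ℝ⟦X⟧) :
    IsApproximable (Polynomial.eval₂RingHom B.subtype t).range := by
  intro M
  let ev := Polynomial.eval₂RingHom B.subtype t
  suffices H : ∃ (φ : B →+* convergentSeries) (s : convergentSeries),
      (∀ b : B, (b : ℝ⟦X⟧) ∈ convergentSeries → (φ b : ℝ⟦X⟧) = b) ∧
      (∀ b : B, PowerSeries.X ^ M ∣ (φ b : ℝ⟦X⟧) - (b : ℝ⟦X⟧)) ∧ PowerSeries.X ^ M ∣ (s : ℝ⟦X⟧) - t ∧
      ∀ p, ev p = 0 → Polynomial.eval₂RingHom φ s p = 0 by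
    obtain ⟨φ, s, hφA, hφM, hs, hker⟩ := H
    let ψ := Polynomial.eval₂RingHom φ s
    let Φ := RingHom.liftOfSurjective ev.rangeRestrict ev.rangeRestrict_surjective
      ⟨ψ, fun p hp => hker p (by
        have := congrArg Subtype.val (RingHom.mem_ker.1 hp)
        simpa using this)⟩
    have hΦ : ∀ p, Φ (ev.rangeRestrict p) = ψ p := fun p =>
      RingHom.liftOfRightInverse_comp_apply _ _ _ _ p
    refine ⟨Φ, fun b hb => ?_, fun b => ?_⟩
    · have e1 : b = ev.rangeRestrict (Polynomial.C ⟨b, hAB hb⟩) := by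
        apply Subtype.ext
        simp [ev]
      rw [e1, hΦ]
      simp only [ψ, ev, Polynomial.coe_eval₂RingHom, Polynomial.eval₂_C,
        RingHom.coe_rangeRestrict]
      exact hφA ⟨b, hAB hb⟩ hb
    · obtain ⟨p, rfl⟩ := ev.rangeRestrict_surjective b
      rw [hΦ]
      have e1 : (ψ p : ℝ⟦X⟧) = p.eval₂ (convergentSeries.subtype.comp φ) s :=
        Polynomial.hom_eval₂ p φ convergentSeries.subtype s
      rw [e1]
      exact dvd_eval₂_sub_eval₂ hφM hs p
  -- for `t` transcendental over `B` every value near `t` is allowed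
  by_cases htr : ∀ p, ev p = 0 → p = 0
  · obtain ⟨φ, h1, h2⟩ := hB M
    obtain ⟨s, hs⟩ := exists_X_pow_dvd_coe_sub t M
    exact ⟨φ, s, h1, h2, hs, fun p hp => by rw [htr p hp, map_zero]⟩
  push Not at htr
  obtain ⟨f, ⟨hf, hf0⟩, hmin'⟩ := exists_minimalFor_of_wellFoundedLT
    (fun p : B[X] => ev p = 0 ∧ p ≠ 0) Polynomial.natDegree htr
  have hmin : ∀ p, p ≠ 0 → ev p = 0 → f.natDegree ≤ p.natDegree := by
    intro p hp hp'
    by_contra! hlt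
    exact absurd (hmin' ⟨hp', hp⟩ hlt.le) (not_le.2 hlt)
  have hc : (f.leadingCoeff : ℝ⟦X⟧) ≠ 0 := by simpa using hf0
  have hdeg : 0 < f.natDegree := by
    rw [Nat.pos_iff_ne_zero]
    intro h
    rw [Polynomial.eq_C_of_natDegree_eq_zero h] at hf hc
    refine hc ?_
    simpa [ev] using hf
  have hd : ev f.derivative ≠ 0 := by
    intro h
    have : IsAddTorsionFree ℝ⟦X⟧ := .of_module_rat _
    have : IsAddTorsionFree B :=
      Function.Injective.isAddTorsionFree B.subtype.toAddMonoidHom B.subtype_injective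
    have h2 : f.derivative ≠ 0 := fun h' => hdeg.ne' (Polynomial.derivative_eq_zero.1 h')
    exact absurd (hmin _ h2 h) (not_le.2 (Polynomial.natDegree_derivative_lt hdeg.ne'))
  obtain ⟨m, -, hm⟩ := exists_X_pow_dvd_and_not_dvd hc
  obtain ⟨e, he, he'⟩ := exists_X_pow_dvd_and_not_dvd hd
  -- the precision serves Hensel's lemma and keeps the image of the leading coefficient nonzero
  obtain ⟨φ, hφA, hφM⟩ := hB (2 * e + 1 + M + (m + 1))
  have hclose : ∀ p : B[X], PowerSeries.X ^ (2 * e + 1 + M + (m + 1)) ∣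
      (p.map φ).eval₂ convergentSeries.subtype t - ev p := by
    intro p
    rw [Polynomial.eval₂_map]
    exact dvd_eval₂_sub_eval₂ hφM (by simp) p
  obtain ⟨s, hs, hst⟩ := exists_convergent_root (f.map φ) t e M
    (by
      have := hclose f
      rw [hf, sub_zero] at this
      exact (pow_dvd_pow _ (by omega)).trans this)
    (by
      rw [Polynomial.derivative_map]
      have := (pow_dvd_pow _ (by omega : e ≤ _)).trans (hclose f.derivative)
      exact (dvd_iff_dvd_of_dvd_sub this).2 he)
    (by
      rw [Polynomial.derivative_map]
      intro h
      have := (pow_dvd_pow _ (by omega : e + 1 ≤ _)).trans (hclose f.derivative)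
      exact he' ((dvd_iff_dvd_of_dvd_sub this).1 h))
  refine ⟨φ, s, hφA, fun b => (pow_dvd_pow _ (by omega)).trans (hφM b), hst, fun p hp => ?_⟩
  refine map_eq_zero_of_minimal ev (Polynomial.eval₂RingHom φ s) f hf hdeg hmin ?_ ?_ p hp
  · rwa [Polynomial.eval_map] at hs
  · intro h
    rw [Polynomial.coe_eval₂RingHom, Polynomial.eval₂_C] at h
    have := (pow_dvd_pow _ (by omega : m + 1 ≤ _)).trans (hφM f.leadingCoeff)
    rw [h] at this
    exact hm (by simpa using this)

/-- **Artin approximation** in one variable: any finite set of formal power series lies in an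
approximable subring containing `ℝ{{h}}`. -/
theorem exists_isApproximable (s : Finset ℝ⟦X⟧) :
    ∃ B : Subring ℝ⟦X⟧, convergentSeries ≤ B ∧ (∀ y ∈ s, y ∈ B) ∧ IsApproximable B := by
  classical
  induction s using Finset.induction_on with
  | empty =>
    exact ⟨convergentSeries, le_rfl, by simp,
      fun M => ⟨RingHom.id _, fun _ _ => rfl, fun b => by simp⟩⟩
  | insert t s _ ih =>
    obtain ⟨B, hAB, hsB, hB⟩ := ih
    have hle : B ≤ (Polynomial.eval₂RingHom B.subtype t).range := fun b hb =>
      ⟨Polynomial.C ⟨b, hb⟩, by simp⟩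
    refine ⟨_, hAB.trans hle, fun y hy => ?_, hB.adjoin hAB t⟩
    rcases Finset.mem_insert.1 hy with rfl | hy
    · exact ⟨Polynomial.X, by simp⟩
    · exact hle (hsB y hy)

/-! ### Even and odd parts -/

/-- The substitution `h ↦ h²` on formal power series. -/
noncomputable abbrev expandTwo : ℝ⟦X⟧ →ₐ[ℝ] ℝ⟦X⟧ := PowerSeries.expand 2 two_ne_zero

/-- The series `u` in the decomposition `f(h) = u(h²) + h v(h²)`. -/
noncomputable def evenPart : ℝ⟦X⟧ →+ ℝ⟦X⟧ where
  toFun f := PowerSeries.mk fun n => PowerSeries.coeff (2 * n) f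
  map_zero' := by ext; simp
  map_add' f g := by ext; simp

/-- The series `v` in the decomposition `f(h) = u(h²) + h v(h²)`. -/
noncomputable def oddPart : ℝ⟦X⟧ →+ ℝ⟦X⟧ where
  toFun f := PowerSeries.mk fun n => PowerSeries.coeff (2 * n + 1) f
  map_zero' := by ext; simp
  map_add' f g := by ext; simp

@[simp]
theorem coeff_evenPart (f : ℝ⟦X⟧) (n : ℕ) :
    PowerSeries.coeff n (evenPart f) = PowerSeries.coeff (2 * n) f :=
  PowerSeries.coeff_mk n fun n => PowerSeries.coeff (2 * n) f

@[simp]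
theorem coeff_oddPart (f : ℝ⟦X⟧) (n : ℕ) :
    PowerSeries.coeff n (oddPart f) = PowerSeries.coeff (2 * n + 1) f :=
  PowerSeries.coeff_mk n fun n => PowerSeries.coeff (2 * n + 1) f

theorem coeff_two_mul_expandTwo (f : ℝ⟦X⟧) (n : ℕ) :
    PowerSeries.coeff (2 * n) (expandTwo f) = PowerSeries.coeff n f :=
  PowerSeries.coeff_expand_mul _ _ _ _

theorem coeff_two_mul_add_one_expandTwo (f : ℝ⟦X⟧) (n : ℕ) :
    PowerSeries.coeff (2 * n + 1) (expandTwo f) = 0 :=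
  PowerSeries.coeff_expand_of_not_dvd _ _ _ (by omega)

theorem evenPart_expandTwo_add (a b : ℝ⟦X⟧) :
    evenPart (expandTwo a + PowerSeries.X * expandTwo b) = a := by
  ext n
  rw [coeff_evenPart, map_add, coeff_two_mul_expandTwo]
  cases n with
  | zero => simp
  | succ n =>
    rw [show 2 * (n + 1) = 2 * n + 1 + 1 by ring, PowerSeries.coeff_succ_X_mul,
      coeff_two_mul_add_one_expandTwo, add_zero]

theorem oddPart_expandTwo_add (a b : ℝ⟦X⟧) :
    oddPart (expandTwo a + PowerSeries.X * expandTwo b) = b := by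
  ext n
  rw [coeff_oddPart, map_add, coeff_two_mul_add_one_expandTwo, PowerSeries.coeff_succ_X_mul,
    coeff_two_mul_expandTwo, zero_add]

theorem expandTwo_evenPart_add (f : ℝ⟦X⟧) :
    expandTwo (evenPart f) + PowerSeries.X * expandTwo (oddPart f) = f := by
  ext n
  obtain ⟨k, rfl | rfl⟩ := Nat.even_or_odd' n
  · rw [← coeff_evenPart, evenPart_expandTwo_add, coeff_evenPart]
  · rw [← coeff_oddPart, oddPart_expandTwo_add, coeff_oddPart]

theorem mul_eq_expandTwo_add (f g : ℝ⟦X⟧) : f * g =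
    expandTwo (evenPart f * evenPart g + PowerSeries.X * (oddPart f * oddPart g)) +
      PowerSeries.X * expandTwo (evenPart f * oddPart g + oddPart f * evenPart g) := by
  conv_lhs => rw [← expandTwo_evenPart_add f, ← expandTwo_evenPart_add g]
  simp only [map_add, map_mul, expandTwo, PowerSeries.expand_X]
  ring

theorem evenPart_mul (f g : ℝ⟦X⟧) : evenPart (f * g) =
    evenPart f * evenPart g + PowerSeries.X * (oddPart f * oddPart g) := by
  rw [mul_eq_expandTwo_add, evenPart_expandTwo_add]

theorem oddPart_mul (f g : ℝ⟦X⟧) :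
    oddPart (f * g) = evenPart f * oddPart g + oddPart f * evenPart g := by
  rw [mul_eq_expandTwo_add, oddPart_expandTwo_add]

theorem evenPart_one : evenPart 1 = 1 := by
  simpa using evenPart_expandTwo_add 1 0

theorem oddPart_one : oddPart 1 = 0 := by
  simpa using oddPart_expandTwo_add 1 0

theorem evenPart_evalNegHom (f : ℝ⟦X⟧) : evenPart (PowerSeries.evalNegHom f) = evenPart f := by
  ext n
  simp [PowerSeries.evalNegHom]

theorem oddPart_evalNegHom (f : ℝ⟦X⟧) : oddPart (PowerSeries.evalNegHom f) = -oddPart f := by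
  ext n
  simp [PowerSeries.evalNegHom, pow_succ]

theorem evenPart_mem {f : ℝ⟦X⟧} (hf : f ∈ convergentSeries) : evenPart f ∈ convergentSeries := by
  obtain ⟨r, hr, h⟩ := (hasPosRadius_iff_wnorm _).1 hf
  refine (hasPosRadius_iff_wnorm _).2 ⟨r ^ 2, by positivity, ne_top_of_le_ne_top h ?_⟩
  unfold wnorm
  have := ENNReal.tsum_comp_le_tsum_of_injective (mul_right_injective₀ (two_ne_zero (α := ℕ)))
    (fun n => ‖PowerSeries.coeff n f‖ₑ * (r : ℝ≥0∞) ^ n)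
  refine le_trans (le_of_eq (tsum_congr fun n => ?_)) this
  simp [pow_mul]

theorem oddPart_mem {f : ℝ⟦X⟧} (hf : f ∈ convergentSeries) : oddPart f ∈ convergentSeries := by
  have h : evenPart (PowerSeries.X * f) = PowerSeries.X * oddPart f := by
    have e1 : PowerSeries.X * f =
        expandTwo (PowerSeries.X * oddPart f) + PowerSeries.X * expandTwo (evenPart f) := by
      conv_lhs => rw [← expandTwo_evenPart_add f]
      simp only [map_mul, expandTwo, PowerSeries.expand_X]
      ring
    rw [e1, evenPart_expandTwo_add]
  exact of_X_mul_mem (h ▸ evenPart_mem (mul_mem X_mem hf))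

theorem expandTwo_mem {f : ℝ⟦X⟧} (hf : f ∈ convergentSeries) :
    expandTwo f ∈ convergentSeries := by
  obtain ⟨r, hr, h⟩ := (hasPosRadius_iff_wnorm _).1 hf
  refine (hasPosRadius_iff_wnorm _).2 ⟨NNReal.sqrt r, NNReal.sqrt_pos.2 hr, ?_⟩
  convert h using 1
  unfold wnorm
  have hinj : Function.Injective fun n : ℕ => 2 * n := mul_right_injective₀ two_ne_zero
  rw [← hinj.tsum_eq]
  · refine tsum_congr fun n => ?_
    rw [coeff_two_mul_expandTwo, pow_mul, ← ENNReal.coe_pow, NNReal.sq_sqrt]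
  · intro n hn
    obtain ⟨k, rfl | rfl⟩ := Nat.even_or_odd' n
    · exact ⟨k, rfl⟩
    · simp [coeff_two_mul_add_one_expandTwo] at hn

/-! ### Approximation compatible with `h ↦ -h` -/

/-- The series whose even and odd parts lie in `B`. -/
noncomputable def parityExtension (B : Subring ℝ⟦X⟧) (hX : PowerSeries.X ∈ B) :
    Subring ℝ⟦X⟧ where
  carrier := {f | evenPart f ∈ B ∧ oddPart f ∈ B}
  mul_mem' {f g} hf hg := by
    simp only [Set.mem_ofPred_eq, evenPart_mul, oddPart_mul]
    exact ⟨add_mem (mul_mem hf.1 hg.1) (mul_mem hX (mul_mem hf.2 hg.2)),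
      add_mem (mul_mem hf.1 hg.2) (mul_mem hf.2 hg.1)⟩
  one_mem' := by simp [evenPart_one, oddPart_one, one_mem, zero_mem]
  add_mem' {f g} hf hg := by
    simp only [Set.mem_ofPred_eq, map_add]
    exact ⟨add_mem hf.1 hg.1, add_mem hf.2 hg.2⟩
  zero_mem' := by simp [zero_mem]
  neg_mem' {f} hf := by
    simp only [Set.mem_ofPred_eq, map_neg]
    exact ⟨neg_mem hf.1, neg_mem hf.2⟩

section

variable {B : Subring ℝ⟦X⟧} {hX : PowerSeries.X ∈ B}

/-- The even part of an element of the parity extension of `B`, as an element of `B`. -/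
noncomputable def parityExtensionEven (f : parityExtension B hX) : B := ⟨evenPart f, f.2.1⟩

/-- The odd part of an element of the parity extension of `B`, as an element of `B`. -/
noncomputable def parityExtensionOdd (f : parityExtension B hX) : B := ⟨oddPart f, f.2.2⟩

theorem parityExtensionEven_add (f g : parityExtension B hX) :
    parityExtensionEven (f + g) = parityExtensionEven f + parityExtensionEven g :=
  Subtype.ext (map_add evenPart _ _)

theorem parityExtensionOdd_add (f g : parityExtension B hX) :
    parityExtensionOdd (f + g) = parityExtensionOdd f + parityExtensionOdd g :=
  Subtype.ext (map_add oddPart _ _)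

theorem parityExtensionEven_mul (f g : parityExtension B hX) :
    parityExtensionEven (f * g) = parityExtensionEven f * parityExtensionEven g +
      ⟨PowerSeries.X, hX⟩ * (parityExtensionOdd f * parityExtensionOdd g) :=
  Subtype.ext (evenPart_mul _ _)

theorem parityExtensionOdd_mul (f g : parityExtension B hX) :
    parityExtensionOdd (f * g) = parityExtensionEven f * parityExtensionOdd g +
      parityExtensionOdd f * parityExtensionEven g :=
  Subtype.ext (oddPart_mul _ _)

theorem parityExtensionEven_one : parityExtensionEven (1 : parityExtension B hX) = 1 :=
  Subtype.ext evenPart_one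

theorem parityExtensionOdd_one : parityExtensionOdd (1 : parityExtension B hX) = 0 :=
  Subtype.ext oddPart_one

theorem parityExtensionEven_zero : parityExtensionEven (0 : parityExtension B hX) = 0 :=
  Subtype.ext (map_zero evenPart)

theorem parityExtensionOdd_zero : parityExtensionOdd (0 : parityExtension B hX) = 0 :=
  Subtype.ext (map_zero oddPart)

/-- A homomorphism that fixes `X` extends to the parity extension, acting on the even and odd
parts separately. -/
noncomputable def parityExtensionHom (φ : B →+* convergentSeries)
    (hφ : (φ ⟨PowerSeries.X, hX⟩ : ℝ⟦X⟧) = PowerSeries.X) :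
    parityExtension B hX →+* convergentSeries where
  toFun f := ⟨expandTwo (φ (parityExtensionEven f)) +
      PowerSeries.X * expandTwo (φ (parityExtensionOdd f)),
    add_mem (expandTwo_mem (φ _).2) (mul_mem X_mem (expandTwo_mem (φ _).2))⟩
  map_one' := by
    apply Subtype.ext
    simp [parityExtensionEven_one, parityExtensionOdd_one]
  map_zero' := by
    apply Subtype.ext
    simp [parityExtensionEven_zero, parityExtensionOdd_zero]
  map_add' f g := by
    apply Subtype.ext
    simp only [parityExtensionEven_add, parityExtensionOdd_add, map_add, Subring.coe_add]
    ring
  map_mul' f g := by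
    apply Subtype.ext
    simp only [parityExtensionEven_mul, parityExtensionOdd_mul, map_add, map_mul,
      Subring.coe_add, Subring.coe_mul, hφ, expandTwo, PowerSeries.expand_X]
    ring

end

theorem expandTwo_pow_dvd {f : ℝ⟦X⟧} {n : ℕ} (h : PowerSeries.X ^ n ∣ f) :
    PowerSeries.X ^ n ∣ expandTwo f := by
  have h' := map_dvd expandTwo h
  rw [map_pow, expandTwo, PowerSeries.expand_X, ← pow_mul] at h'
  exact (pow_dvd_pow _ (by omega)).trans h'

/-- Artin approximation compatible with `h ↦ -h`: the approximation is carried out for the even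
and odd parts, as series in `h²`. -/
theorem exists_equivariant_approximation (s : Finset ℝ⟦X⟧) :
    ∃ B : Subring ℝ⟦X⟧, (∀ y ∈ s, y ∈ B) ∧ ∀ M : ℕ, ∃ φ : B →+* convergentSeries,
      (∀ b : B, (b : ℝ⟦X⟧) ∈ convergentSeries → (φ b : ℝ⟦X⟧) = b) ∧
      (∀ b : B, PowerSeries.X ^ M ∣ (φ b : ℝ⟦X⟧) - (b : ℝ⟦X⟧)) ∧
      ∀ b b' : B, (b' : ℝ⟦X⟧) = PowerSeries.evalNegHom (b : ℝ⟦X⟧) →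
        (φ b' : ℝ⟦X⟧) = PowerSeries.evalNegHom (φ b : ℝ⟦X⟧) := by
  classical
  obtain ⟨B, hAB, hsB, hB⟩ := exists_isApproximable (s.image evenPart ∪ s.image oddPart)
  have hX : PowerSeries.X ∈ B := hAB X_mem
  refine ⟨parityExtension B hX, fun y hy => ⟨hsB _ ?_, hsB _ ?_⟩, fun M => ?_⟩
  · exact Finset.mem_union_left _ (Finset.mem_image_of_mem _ hy)
  · exact Finset.mem_union_right _ (Finset.mem_image_of_mem _ hy)
  obtain ⟨φ, hφA, hφM⟩ := hB M
  let ψ := parityExtensionHom φ (hφA ⟨_, hX⟩ X_mem)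
  have hψ : ∀ f : parityExtension B hX, (ψ f : ℝ⟦X⟧) = expandTwo (φ (parityExtensionEven f)) +
    PowerSeries.X * expandTwo (φ (parityExtensionOdd f)) := fun _ => rfl
  have hdec : ∀ f : parityExtension B hX, (f : ℝ⟦X⟧) =
    expandTwo (parityExtensionEven f : ℝ⟦X⟧) +
      PowerSeries.X * expandTwo (parityExtensionOdd f : ℝ⟦X⟧) :=
    fun f => (expandTwo_evenPart_add (f : ℝ⟦X⟧)).symm
  refine ⟨ψ, fun f hf => ?_, fun f => ?_, fun f f' hff' => ?_⟩
  · rw [hψ, hφA (parityExtensionEven f) (evenPart_mem hf),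
      hφA (parityExtensionOdd f) (oddPart_mem hf), ← hdec]
  · rw [hψ, hdec f, add_sub_add_comm, ← mul_sub, ← map_sub, ← map_sub]
    exact dvd_add (expandTwo_pow_dvd (hφM _)) ((expandTwo_pow_dvd (hφM _)).mul_left _)
  · have e1 : parityExtensionEven f' = parityExtensionEven f :=
      Subtype.ext ((congrArg evenPart hff').trans (evenPart_evalNegHom _))
    have e2 : parityExtensionOdd f' = -parityExtensionOdd f :=
      Subtype.ext ((congrArg oddPart hff').trans (oddPart_evalNegHom _))
    rw [← expandTwo_evenPart_add (PowerSeries.evalNegHom (ψ f : ℝ⟦X⟧)), evenPart_evalNegHom,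
      oddPart_evalNegHom, hψ f, evenPart_expandTwo_add, oddPart_expandTwo_add, hψ f', e1, e2]
    simp

/-! ### Burnside's criterion for absolute irreducibility -/

/-- **Burnside's theorem**: over an algebraically closed field, the operators of an irreducible
representation span the algebra of all endomorphisms. -/
theorem span_range_eq_top_of_isIrreducible {G K V : Type*} [Group G] [Field K] [IsAlgClosed K]
    [AddCommGroup V] [Module K V] [FiniteDimensional K V] (ρ : Representation K G V)
    (h : ρ.IsIrreducible) : Submodule.span K (Set.range ρ) = ⊤ := by
  let A := MonoidAlgebra K G
  let W := ρ.asModule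
  have hspan : ∀ a : A, ρ.asAlgebraHom a ∈ Submodule.span K (Set.range ρ) := by
    intro a
    induction a using MonoidAlgebra.induction_linear with
    | zero => simp
    | add a b ha hb => rw [map_add]; exact add_mem ha hb
    | single g c =>
      rw [Representation.asAlgebraHom_single]
      exact Submodule.smul_mem _ _ (Submodule.subset_span ⟨g, rfl⟩)
  have hsimple : IsSimpleModule A W :=
    (Representation.irreducible_iff_isSimpleModule_asModule ρ).1 h
  -- by Schur's lemma the commutant consists of the scalars
  have hschur : Function.Bijective (algebraMap K (Module.End A W)) :=
    IsSimpleModule.algebraMap_end_bijective_of_isAlgClosed K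
  have : Module.Finite (Module.End A W) W := by
    have : IsScalarTower K (Module.End A W) W := ⟨fun c f w => rfl⟩
    exact Module.Finite.of_restrictScalars_finite K _ _
  rw [eq_top_iff]
  rintro f -
  let f' : Module.End (Module.End A W) W :=
    { toFun := fun w => ρ.asModuleEquiv.symm (f (ρ.asModuleEquiv w))
      map_add' := fun v w => by simp
      map_smul' := fun c w => by
        obtain ⟨c, rfl⟩ := hschur.2 c
        simp }
  obtain ⟨a, ha⟩ := Module.Finite.toModuleEnd_moduleEnd_surjective (R := A) (M := W) f'
  have hfa : f = ρ.asAlgebraHom a := by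
    ext v
    have h1 : a • ρ.asModuleEquiv.symm v = ρ.asModuleEquiv.symm (f v) :=
      (DFunLike.congr_fun ha (ρ.asModuleEquiv.symm v)).trans (by simp [f'])
    have h2 := congrArg ρ.asModuleEquiv h1
    rw [Representation.asModuleEquiv_map_smul] at h2
    simpa using h2.symm
  rw [hfa]
  exact hspan a

/-- A representation whose operators span the algebra of all endomorphisms is irreducible. -/
theorem isIrreducible_of_span_range_eq_top {G K V : Type*} [Group G] [Field K]
    [AddCommGroup V] [Module K V] [Nontrivial V] (ρ : Representation K G V)
    (h : Submodule.span K (Set.range ρ) = ⊤) : ρ.IsIrreducible := by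
  have hne : (⊥ : Subrepresentation ρ) ≠ ⊤ := by
    intro h
    have : (⊥ : Submodule K V) = ⊤ := congrArg Subrepresentation.toSubmodule h
    exact bot_ne_top this
  have : Nontrivial (Subrepresentation ρ) := ⟨_, _, hne⟩
  refine ⟨fun W => ?_⟩
  by_cases hW : W.toSubmodule = ⊥
  · exact Or.inl (Subrepresentation.toSubmodule_injective hW)
  refine Or.inr (Subrepresentation.toSubmodule_injective ?_)
  obtain ⟨w, hw, hw0⟩ := Submodule.exists_mem_ne_zero_of_ne_bot hW
  change W.toSubmodule = ⊤
  rw [eq_top_iff]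
  rintro v -
  obtain ⟨f, rfl⟩ : ∃ f : Module.End K V, f w = v := by
    obtain ⟨l, hl⟩ := Module.Projective.exists_dual_eq_one K hw0
    exact ⟨l.smulRight v, by simp [hl]⟩
  have hf : f ∈ Submodule.span K (Set.range ρ) := h ▸ Submodule.mem_top
  induction hf using Submodule.span_induction with
  | mem x hx => obtain ⟨g, rfl⟩ := hx; exact W.apply_mem_toSubmodule g hw
  | zero => exact zero_mem _
  | add x y _ _ hx hy => exact add_mem hx hy
  | smul c x _ hx => exact W.toSubmodule.smul_mem c hx

/-- The square matrix whose rows are the flattened `N × N` matrices `A i`. Over a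
field, its determinant is nonzero exactly when the `A i` form a basis of the space of matrices. -/
def flattenedMatrix {N : ℕ} {K : Type*} (A : Fin N × Fin N → Matrix (Fin N) (Fin N) K) :
    Matrix (Fin N × Fin N) (Fin N × Fin N) K := Matrix.of fun i p => A i p.1 p.2

theorem span_range_matrixRep_eq_top_iff {G K : Type*} [Group G] [Field K] {N : ℕ}
    (ρ : G →* GL (Fin N) K) : Submodule.span K (Set.range (matrixRep ρ)) = ⊤ ↔
      ∃ x : Fin N × Fin N → G, (flattenedMatrix fun i => (ρ (x i)).val).det ≠ 0 := by
  -- flattening identifies endomorphisms with functions on pairs of indices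
  let e : Module.End K (Fin N → K) ≃ₗ[K] (Fin N × Fin N → K) :=
    (LinearMap.toMatrix' : _ ≃ₗ[K] Matrix (Fin N) (Fin N) K).trans
      (LinearEquiv.curry K K (Fin N) (Fin N)).symm
  have he : ∀ x p, e (matrixRep ρ x) p = (ρ x).val p.1 p.2 := by
    intro x p
    have h1 : matrixRep ρ x = Matrix.toLin' (ρ x).val := rfl
    rw [h1]
    change LinearMap.toMatrix' (Matrix.toLin' (ρ x).val) p.1 p.2 = _
    rw [LinearMap.toMatrix'_toLin']
  have h1 : Submodule.span K (Set.range (matrixRep ρ)) = ⊤ ↔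
      Submodule.span K (Set.range fun x => e (matrixRep ρ x)) = ⊤ := by
    rw [show (Set.range fun x => e (matrixRep ρ x)) = (e : _ →ₗ[K] _) '' Set.range (matrixRep ρ) by
      rw [← Set.range_comp]; rfl, ← Submodule.map_span]
    exact Submodule.map_eq_top_iff.symm
  rw [h1]
  constructor
  · intro h
    obtain ⟨f, hf, -, hli⟩ :=
      Submodule.exists_fun_fin_finrank_span_eq K (Set.range fun x => e (matrixRep ρ x))
    have hcard : Module.finrank K (Submodule.span K (Set.range fun x => e (matrixRep ρ x))) =
        Fintype.card (Fin N × Fin N) := by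
      rw [h, finrank_top, Module.finrank_fintype_fun_eq_card]
    let eq := (Fintype.equivFinOfCardEq hcard.symm)
    choose y hy using hf
    refine ⟨fun i => y (eq i), ?_⟩
    rw [← isUnit_iff_ne_zero, ← Matrix.isUnit_iff_isUnit_det,
      ← Matrix.linearIndependent_rows_iff_isUnit]
    have hrow : (flattenedMatrix fun i => (ρ (y (eq i))).val).row = f ∘ eq := by
      funext i p
      rw [Function.comp_apply, ← hy]
      exact (he _ _).symm
    rw [hrow]
    exact hli.comp eq eq.injective
  · rintro ⟨x, hx⟩
    rw [← isUnit_iff_ne_zero, ← Matrix.isUnit_iff_isUnit_det,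
      ← Matrix.linearIndependent_rows_iff_isUnit] at hx
    have := hx.span_eq_top_of_card_eq_finrank' (by rw [Module.finrank_fintype_fun_eq_card])
    rw [eq_top_iff, ← this]
    apply Submodule.span_mono
    rintro _ ⟨i, rfl⟩
    refine ⟨x i, ?_⟩
    funext p
    exact he _ _

theorem isAbsolutelyIrreducible_iff {G K : Type*} [Group G] [Field K] {N : ℕ}
    (ρ : G →* GL (Fin N) K) : IsAbsolutelyIrreducible ρ ↔
      0 < N ∧ ∃ x : Fin N × Fin N → G, (flattenedMatrix fun i => (ρ (x i)).val).det ≠ 0 := by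
  have hdet : ∀ x : Fin N × Fin N → G,
      (flattenedMatrix fun i => ((Matrix.GeneralLinearGroup.map
        (algebraMap K (AlgebraicClosure K))).comp ρ (x i)).val).det =
      algebraMap K (AlgebraicClosure K) (flattenedMatrix fun i => (ρ (x i)).val).det := by
    intro x
    rw [RingHom.map_det]
    rfl
  have hspan := span_range_matrixRep_eq_top_iff ((Matrix.GeneralLinearGroup.map
    (algebraMap K (AlgebraicClosure K))).comp ρ)
  simp only [hdet, ne_eq, map_eq_zero] at hspan
  rw [IsAbsolutelyIrreducible, ← hspan]
  constructor
  · intro h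
    refine ⟨Nat.pos_of_ne_zero ?_, span_range_eq_top_of_isIrreducible _ h⟩
    rintro rfl
    exact bot_ne_top (Subrepresentation.toSubmodule_injective (Subsingleton.elim
      (⊥ : Submodule (AlgebraicClosure K) (Fin 0 → AlgebraicClosure K)) ⊤) :
      (⊥ : Subrepresentation (matrixRep ((Matrix.GeneralLinearGroup.map
        (algebraMap K (AlgebraicClosure K))).comp ρ))) = ⊤)
  · rintro ⟨hN, h⟩
    have : Nonempty (Fin N) := ⟨⟨0, hN⟩⟩
    exact isIrreducible_of_span_range_eq_top _ h

/-! ### Representations over power series -/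

/-- The entries of a matrix representation lie in any subring that contains the entries of the
images of the generators and of their inverses. -/
theorem entries_mem_of_closure_eq_top {G A : Type*} [Group G] [CommRing A] {N : ℕ}
    (R : G →* GL (Fin N) A) (B : Subring A) {S : Set G} (hS : Subgroup.closure S = ⊤)
    (h : ∀ x ∈ S, ∀ a b, (R x).val a b ∈ B) (h' : ∀ x ∈ S, ∀ a b, (R x⁻¹).val a b ∈ B)
    (x : G) (a b : Fin N) : (R x).val a b ∈ B := by
  have hx : x ∈ Subgroup.closure S := hS ▸ Subgroup.mem_top x
  rw [← Subgroup.mem_toSubmonoid, Subgroup.closure_toSubmonoid] at hx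
  induction hx using Submonoid.closure_induction generalizing a b with
  | mem x hx =>
    rcases hx with hx | hx
    · exact h x hx a b
    · simpa using h' x⁻¹ hx a b
  | one =>
    rw [map_one, Units.val_one, Matrix.one_apply]
    split_ifs
    exacts [one_mem B, zero_mem B]
  | mul x y _ _ hx hy =>
    rw [map_mul, Units.val_mul, Matrix.mul_apply]
    exact sum_mem fun c _ => mul_mem (hx a c) (hy c b)

/-- A matrix representation with entries in a subring `B`, as a representation over the subring. -/
def restrictEntries {G A : Type*} [Group G] [CommRing A] {N : ℕ} (R : G →* GL (Fin N) A)
    (B : Subring A) (h : ∀ x a b, (R x).val a b ∈ B) : G →* GL (Fin N) B :=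
  MonoidHom.toHomUnits
    { toFun := fun x => Matrix.of fun a b => ⟨(R x).val a b, h x a b⟩
      map_one' := by
        ext a b
        simp only [map_one, Units.val_one, Matrix.of_apply, Matrix.one_apply]
        split_ifs <;> rfl
      map_mul' := fun x y => by
        ext a b
        simp [Matrix.mul_apply] }

theorem epsilon_algebraMap (f : ℝ⟦X⟧) :
    epsilon (algebraMap ℝ⟦X⟧ ℝ⸨X⸩ f) = algebraMap ℝ⟦X⟧ ℝ⸨X⸩ (PowerSeries.evalNegHom f) := by
  ext n
  change (-1 : ℝ) ^ n * (HahnSeries.ofPowerSeries ℤ ℝ f).coeff n =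
    (HahnSeries.ofPowerSeries ℤ ℝ _).coeff n
  rw [PowerSeries.coeff_coe, PowerSeries.coeff_coe]
  split_ifs with hn
  · simp
  · lift n to ℕ using not_lt.1 hn
    simp [PowerSeries.evalNegHom]

theorem algebraMap_laurentSeries_injective : Function.Injective (algebraMap ℝ⟦X⟧ ℝ⸨X⸩) :=
  HahnSeries.ofPowerSeries_injective

/-- For a representation over power series, unitarity with respect to `ε` can be read off
from the entries. -/
theorem inv_eq_transpose_epsilon_iff {G : Type*} [Group G] {N : ℕ} (R : G →* GL (Fin N) ℝ⟦X⟧)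
    (x : G) :
    (((Matrix.GeneralLinearGroup.map (algebraMap ℝ⟦X⟧ ℝ⸨X⸩) (R x))⁻¹ : GL (Fin N) ℝ⸨X⸩) :
      Matrix (Fin N) (Fin N) ℝ⸨X⸩) = ((Matrix.GeneralLinearGroup.map (algebraMap ℝ⟦X⟧ ℝ⸨X⸩)
        (R x) : Matrix (Fin N) (Fin N) ℝ⸨X⸩).map epsilon).transpose ↔
      ∀ a b, (R x⁻¹).val a b = PowerSeries.evalNegHom ((R x).val b a) := by
  rw [← map_inv, ← map_inv, ← Matrix.ext_iff]
  refine forall_congr' fun a => forall_congr' fun b => ?_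
  rw [Matrix.transpose_apply, Matrix.map_apply, Matrix.GeneralLinearGroup.map_apply,
    Matrix.GeneralLinearGroup.map_apply, epsilon_algebraMap,
    algebraMap_laurentSeries_injective.eq_iff]

end ConvergentApproximation

open ConvergentApproximation in
theorem mainTheorem5 {G : Type*} [Group G] [Group.FG G] (N : ℕ)
    (R : G →* GL (Fin N) ℝ⟦X⟧) (r : ℕ) (g : Fin r → G)
    (hg : ∀ i a b, (R (g i)).val a b ∈ ConvergentApproximation.convergentSeries)
    (M : ℕ) (hM : 0 < M) :
    ∃ Rs : G →* GL (Fin N) ConvergentApproximation.convergentSeries,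
      (∀ i, Matrix.GeneralLinearGroup.map ConvergentApproximation.convergentSeries.subtype
        (Rs (g i)) = R (g i)) ∧
      (∀ x a b, (PowerSeries.X : ℝ⟦X⟧) ^ M ∣ ((Rs x).val a b : ℝ⟦X⟧) - (R x).val a b) ∧
      ((∀ x, Matrix.GeneralLinearGroup.map (algebraMap ℝ⟦X⟧ ℝ⸨X⸩) (R x) ∈
          ConvergentApproximation.epsilonUnitary N ⊤) →
        ∀ x, Matrix.GeneralLinearGroup.map
          ((algebraMap ℝ⟦X⟧ ℝ⸨X⸩).comp ConvergentApproximation.convergentSeries.subtype)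
            (Rs x) ∈
          ConvergentApproximation.epsilonUnitary N ConvergentApproximation.convergentLaurent) ∧
      (ConvergentApproximation.IsAbsolutelyIrreducible
          ((Matrix.GeneralLinearGroup.map (algebraMap ℝ⟦X⟧ ℝ⸨X⸩)).comp R) →
        ConvergentApproximation.IsAbsolutelyIrreducible
          ((Matrix.GeneralLinearGroup.map
            ConvergentApproximation.convergentSeriesToLaurent).comp Rs)) := by
  classical
  obtain ⟨S, hS⟩ := Group.FG.out (G := G)
  let T : Finset G := S ∪ S.image (·⁻¹)
  let s : Finset ℝ⟦X⟧ :=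
    (T ×ˢ (Finset.univ : Finset (Fin N × Fin N))).image fun p => (R p.1).val p.2.1 p.2.2
  have hs : ∀ x ∈ T, ∀ a b, (R x).val a b ∈ s := fun x hx a b =>
    Finset.mem_image.2 ⟨(x, (a, b)), Finset.mk_mem_product hx (Finset.mem_univ _), rfl⟩
  obtain ⟨B, hsB, hB⟩ := exists_equivariant_approximation s
  have hRB : ∀ x a b, (R x).val a b ∈ B := entries_mem_of_closure_eq_top R B hS
    (fun x hx a b => hsB _ (hs x (Finset.mem_union_left _ hx) a b))
    (fun x hx a b => hsB _ (hs _ (Finset.mem_union_right _ (Finset.mem_image_of_mem _ hx)) a b))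
  -- a precision beyond which the determinant witnessing irreducibility stays nonzero
  obtain ⟨m, hm⟩ : ∃ m : ℕ, IsAbsolutelyIrreducible
      ((Matrix.GeneralLinearGroup.map (algebraMap ℝ⟦X⟧ ℝ⸨X⸩)).comp R) →
      0 < N ∧ ∃ x : Fin N × Fin N → G,
        ¬ PowerSeries.X ^ m ∣ (flattenedMatrix fun i => (R (x i)).val).det := by
    by_cases h : IsAbsolutelyIrreducible
      ((Matrix.GeneralLinearGroup.map (algebraMap ℝ⟦X⟧ ℝ⸨X⸩)).comp R)
    · obtain ⟨hN, x, hx⟩ := (isAbsolutelyIrreducible_iff _).1 h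
      have hx' : (flattenedMatrix fun i => (R (x i)).val).det ≠ 0 := by
        intro h0
        refine hx (Eq.trans ?_ ((congrArg (algebraMap ℝ⟦X⟧ ℝ⸨X⸩) h0).trans (map_zero _)))
        rw [RingHom.map_det]
        rfl
      obtain ⟨e, -, he⟩ := exists_X_pow_dvd_and_not_dvd hx'
      exact ⟨e + 1, fun _ => ⟨hN, x, he⟩⟩
    · exact ⟨0, fun h' => absurd h' h⟩
  obtain ⟨φ, hφA, hφM, hφε⟩ := hB (M + m)
  let RB := restrictEntries R B hRB
  let Rs := (Matrix.GeneralLinearGroup.map φ).comp RB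
  have hRB' : ∀ x a b, ((RB x).val a b : ℝ⟦X⟧) = (R x).val a b := fun _ _ _ => rfl
  have hRs : ∀ x a b, (Rs x).val a b = φ ((RB x).val a b) := fun _ _ _ => rfl
  refine ⟨Rs, fun i => ?_, fun x a b => ?_, fun hU x => ?_, fun hirr => ?_⟩
  · ext a b : 2
    change ((Rs (g i)).val a b : ℝ⟦X⟧) = _
    rw [hRs, hφA ((RB (g i)).val a b) (hg i a b), hRB']
  · rw [hRs, ← hRB']
    exact (pow_dvd_pow _ (Nat.le_add_right _ _)).trans (hφM ((RB x).val a b))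
  · refine ⟨⟨Matrix.GeneralLinearGroup.map convergentSeriesToLaurent (Rs x), rfl⟩, ?_⟩
    refine (inv_eq_transpose_epsilon_iff
      ((Matrix.GeneralLinearGroup.map convergentSeries.subtype).comp Rs) x).2 fun a b => ?_
    exact hφε ((RB x).val b a) ((RB x⁻¹).val a b)
      ((inv_eq_transpose_epsilon_iff R x).1 (hU x).2 a b)
  · obtain ⟨hN, x, hx⟩ := hm hirr
    refine (isAbsolutelyIrreducible_iff _).2 ⟨hN, x, fun h0 => hx ?_⟩
    let D := (flattenedMatrix fun i => (RB (x i)).val).det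
    have hD : (D : ℝ⟦X⟧) = (flattenedMatrix fun i => (R (x i)).val).det := B.subtype.map_det _
    have hφD : convergentSeriesToLaurent (φ D) = 0 := by
      rw [← h0, RingHom.map_det, RingHom.map_det]
      rfl
    have hφD' : (φ D : ℝ⟦X⟧) = 0 :=
      algebraMap_laurentSeries_injective
        ((congrArg Subtype.val hφD).trans (map_zero (algebraMap ℝ⟦X⟧ ℝ⸨X⸩)).symm)
    have := (pow_dvd_pow _ (Nat.le_add_left m M)).trans (hφM D)
    rw [hφD', zero_sub, dvd_neg, hD] at this
    exact this
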